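/- \textbf{Setting.} Let $\mathcal X,\mathcal Y$ be measurable spaces, let $n,k$ be natural numbers and let $\varepsilon>0$, $\tau\in(0,1/2]$. For $t\ge 1$, an \emph{$\varepsilon$-locally differentially private (LDP) channel} is a Markov kernel $W$ from $\mathcal X\times\mathcal Y^{t-1}$ to $\mathcal Y$ such that $W(S\mid x_1,y^{t-1})\le e^{\varepsilon}\,W(S\mid x_2,y^{t-1})$ for all measurable $S\subseteq\mathcal Y$, all $y^{t-1}\in\mathcal Y^{t-1}$ and all $x_1,x_2\in\mathcal X$. A \emph{sequentially interactive $\varepsilon$-LDP protocol} with $n$ players has public randomness $U$ and private randomness $U_1,\dots,U_n$, mutually independent and independent of the samples $X_1,\dots,X_n$; in round $t$, player $t$ selects, as a (measurable) function of $(U,U_t)$, an $\varepsilon$-LDP channel $W_t$ and sends a message $Y_t$ drawn from $W_t(\cdot\mid X_t,Y_1,\dots,Y_{t-1})$. Its messages are $Y^n=(Y_1,\dots,Y_n)$ and its transcript is $(Y^n,U)$. Let $\{p_z\}_{z\in\{-1,+1\}^k}$ be probability measures on $\mathcal X$, and write $z^{\oplus i}$ for $z$ with the sign of its $i$-th coordinate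 flipped. Assume that there are $\alpha\in\mathbb R$, reals $\alpha_{z,i}$ with $|\alpha_{z,i}|\le\alpha$ and measurable functions $\phi_{z,i}\colon\mathcal X\to\mathbb R$ such that, for all $z\in\{-1,+1\}^k$ and $i,j\in\{1,\dots,k\}$, \[ p_{z^{\oplus i}}\ll p_z,\qquad \frac{dp_{z^{\oplus i}}}{dp_z}=1+\alpha_{z,i}\phi_{z,i}\quad p_z\text{-a.e.},\qquad \mathbb E_{p_z}[\phi_{z,i}\phi_{z,j}]=\mathbf 1\{i=j\}. \] Let $Z=(Z_1,\dots,Z_k)$ have independent coordinates in $\{-1,+1\}$ with $\Pr[Z_i=1]=\tau$. Let $p_z^{Y^n}$ denote the law of $Y^n$ when $X_1,\dots,X_n$ are i.i.d. with law $p_z$, and put $p_{+i}^{Y^n}=\mathbb E[p_Z^{Y^n}\mid Z_i=+1]$ and $p_{-i}^{Y^n}=\mathbb E[p_Z^{Y^n}\mid Z_i=-1]$. Let $d_{\mathrm{TV}}(\mu,\nu)=\sup_S|\mu(S)-\nu(S)|$ be the total variation distance. \textbf{Corollary (Local privacy constraints).} Under these assumptions, \[ \Bigl(\frac1k\sum_{i=1}^k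 d_{\mathrm{TV}}\bigl(p_{+i}^{Y^n},p_{-i}^{Y^n}\bigr)\Bigr)^2\le\frac7k\,n\,\alpha^2\,\min\bigl\{(e^{\varepsilon}-1)^2,\;e^{\varepsilon}\bigr\}, \] and the same bound holds when the law of the messages $Y^n$ is replaced throughout by the law of the transcript $(Y^n,U)$. (For $k=0$ both sides are read as $0$.) -/

import Mathlib

open MeasureTheory ProbabilityTheory

noncomputable section

namespace LocalInference

/-- Total variation distance `sup_S |μ(S) - ν(S)|` over measurable sets `S`
(used for probability measures only). -/
def tvDist {Ω : Type*} [MeasurableSpace Ω] (μ ν : Measure Ω) : ℝ :=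
  ⨆ S : {S : Set Ω // MeasurableSet S}, |μ.real S.1 - ν.real S.1|

/-! ### The perturbation space `{-1, +1}^k` -/

/-- The cube `{-1, +1}^k`; the two signs are the units of `ℤ`. -/
abbrev Cube (k : ℕ) : Type := Fin k → ℤˣ

/-- `z` with the sign of its `i`-th coordinate flipped. -/
def flipAt {k : ℕ} (z : Cube k) (i : Fin k) : Cube k := Function.update z i (-z i)

/-- The law on `{-1, +1}` giving mass `τ` to `+1` and `1 - τ` to `-1`. -/
def rademacher (τ : ℝ) : Measure ℤˣ :=
  ENNReal.ofReal τ • Measure.dirac 1 + ENNReal.ofReal (1 - τ) • Measure.dirac (-1)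

/-- The law of `Z`: independent coordinates, each equal to `+1` with probability `τ`. -/
def cubeLaw (k : ℕ) (τ : ℝ) : Measure (Cube k) := Measure.pi fun _ => rademacher τ

/-- `E[Q_Z | Z_i = s]` for a family `Q` of measures indexed by the cube: the mixture of the `Q_z`
with the conditional probabilities of `{Z = z}` given `Z_i = s` as weights. -/
def condMixture {Ω : Type*} [MeasurableSpace Ω] {k : ℕ} (τ : ℝ) (Q : Cube k → Measure Ω)
    (i : Fin k) (s : ℤˣ) : Measure Ω :=
  ∑ z : Cube k, (cond (cubeLaw k τ) {z' | z' i = s}) {z} • Q z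

/-- The average discrepancy `(1/k) ∑_i d_TV(E[Q_Z | Z_i = +1], E[Q_Z | Z_i = -1])`. -/
def avgDiscrepancy {Ω : Type*} [MeasurableSpace Ω] {k : ℕ} (τ : ℝ)
    (Q : Cube k → Measure Ω) : ℝ :=
  (1 / (k : ℝ)) * ∑ i : Fin k, tvDist (condMixture τ Q i 1) (condMixture τ Q i (-1))

/-! ### Assumptions on the family `p_z` -/

/-- Densities exist: `p_{z^{⊕i}} ≪ p_z`, with density `1 + α_{z,i} φ_{z,i}`, `|α_{z,i}| ≤ α`. -/
structure DensitiesExist {𝒳 : Type*} [MeasurableSpace 𝒳] {k : ℕ} (p : Cube k → Measure 𝒳)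
    (α : ℝ) (a : Cube k → Fin k → ℝ) (φ : Cube k → Fin k → 𝒳 → ℝ) : Prop where
  ac : ∀ z i, p (flipAt z i) ≪ p z
  abs_le : ∀ z i, |a z i| ≤ α
  measurable : ∀ z i, Measurable (φ z i)
  density : ∀ z i, ∀ᵐ x ∂(p z), ((p (flipAt z i)).rnDeriv (p z) x).toReal = 1 + a z i * φ z i x

/-- Orthonormality: `E_{p_z}[φ_{z,i} φ_{z,j}] = 1_{i = j}`. The case `i = j` forces
`φ_{z,i} ∈ L²(p_z)`, hence all the products are integrable. -/
def IsOrthonormal {𝒳 : Type*} [MeasurableSpace 𝒳] {k : ℕ} (p : Cube k → Measure 𝒳)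
    (φ : Cube k → Fin k → 𝒳 → ℝ) : Prop :=
  ∀ z i j, ∫ x, φ z i x * φ z j x ∂(p z) = if i = j then 1 else 0

/-! ### Channels and sequentially interactive protocols -/

/-- The set of `ε`-locally differentially private channels from `𝒳 × H` to `𝒴`, where `H` is the
space of the previous messages: Markov kernels `W` with `W(S | x₁, h) ≤ e^ε W(S | x₂, h)`. -/
def ldpChannels (𝒳 H 𝒴 : Type*) [MeasurableSpace 𝒳] [MeasurableSpace H] [MeasurableSpace 𝒴]
    (ε : ℝ) : Set (Kernel (𝒳 × H) 𝒴) :=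
  {W | IsMarkovKernel W ∧ ∀ (h : H) (x₁ x₂ : 𝒳) (S : Set 𝒴), MeasurableSet S →
    W (x₁, h) S ≤ ENNReal.ofReal (Real.exp ε) * W (x₂, h) S}

/-- A sequentially interactive protocol with `n` players, samples in `𝒳`, messages in `𝒴`,
public randomness in `𝒰` and private randomness of player `t` in `𝒱 t`. Player `t` (counted from
`0`, so that `t` messages precede) applies to its sample and to the previous messages a channel
selected by the public randomness and by its own private randomness. -/
structure SeqProtocol (n : ℕ) (𝒳 𝒴 𝒰 : Type*) (𝒱 : Fin n → Type*) [MeasurableSpace 𝒳]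
    [MeasurableSpace 𝒴] [MeasurableSpace 𝒰] [∀ t, MeasurableSpace (𝒱 t)] where
  /-- law of the public randomness `U` -/
  pub : Measure 𝒰
  /-- law of the private randomness `U_t` -/
  priv : ∀ t, Measure (𝒱 t)
  /-- law of the message `Y_t`, given the randomness `(U, U_t)`, the sample `X_t` and the previous
  messages -/
  chan : ∀ t : Fin n, Kernel ((𝒰 × 𝒱 t) × (𝒳 × (Fin t → 𝒴))) 𝒴
  isProb_pub : IsProbabilityMeasure pub
  isProb_priv : ∀ t, IsProbabilityMeasure (priv t)
  isMarkov_chan : ∀ t, IsMarkovKernel (chan t)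

namespace SeqProtocol

variable {n : ℕ} {𝒳 𝒴 𝒰 : Type*} {𝒱 : Fin n → Type*} [MeasurableSpace 𝒳]
    [MeasurableSpace 𝒴] [MeasurableSpace 𝒰] [∀ t, MeasurableSpace (𝒱 t)]

attribute [instance] isProb_pub isProb_priv isMarkov_chan

/-- The channel `W_t = g_t(u, v)` selected by player `t` when `U = u` and `U_t = v`. -/
def selected (P : SeqProtocol n 𝒳 𝒴 𝒰 𝒱) (t : Fin n) (u : 𝒰) (v : 𝒱 t) :
    Kernel (𝒳 × (Fin t → 𝒴)) 𝒴 :=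
  (P.chan t).comap (fun q => ((u, v), q)) measurable_prodMk_left

/-- The protocol uses `(𝒲_1, …, 𝒲_n)`: player `t` only selects channels from `𝒲_t`. -/
def Uses (P : SeqProtocol n 𝒳 𝒴 𝒰 𝒱) (W : ∀ t : Fin n, Set (Kernel (𝒳 × (Fin t → 𝒴)) 𝒴)) :
    Prop :=
  ∀ t u v, P.selected t u v ∈ W t

/-- The channel of player `t` with the arguments in the order
`((public randomness, previous messages), (private randomness, sample))`. -/
def roundKernel (P : SeqProtocol n 𝒳 𝒴 𝒰 𝒱) (t : Fin n) :
    Kernel ((𝒰 × (Fin t → 𝒴)) × (𝒱 t × 𝒳)) 𝒴 :=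
  (P.chan t).comap (fun q => ((q.1.1, q.2.1), (q.2.2, q.1.2))) (by fun_prop)

instance (P : SeqProtocol n 𝒳 𝒴 𝒰 𝒱) (t : Fin n) : IsMarkovKernel (P.roundKernel t) := by
  unfold roundKernel; infer_instance

/-- One round: if the public randomness and the messages before round `t` have joint law `ν`, then
`P.round p t ν` is the joint law after round `t`. The private randomness and the sample (of law
`p`) of player `t` are drawn independently of each other and of the past (they are used in that
round only), the message is drawn from the selected channel and appended to the previous ones. -/
def round (P : SeqProtocol n 𝒳 𝒴 𝒰 𝒱) (p : Measure 𝒳) (t : Fin n)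
    (ν : Measure (𝒰 × (Fin t → 𝒴))) : Measure (𝒰 × (Fin (t + 1) → 𝒴)) :=
  ((ν.prod ((P.priv t).prod p)) ⊗ₘ P.roundKernel t).map
    fun r => (r.1.1.1, (Fin.snoc r.1.1.2 r.2 : Fin (t + 1) → 𝒴))

/-- The joint law of the public randomness and the first `t` messages when the samples are i.i.d.
with law `p`. -/
def lawUpTo (P : SeqProtocol n 𝒳 𝒴 𝒰 𝒱) (p : Measure 𝒳) :
    (t : ℕ) → t ≤ n → Measure (𝒰 × (Fin t → 𝒴))
  | 0, _ => P.pub.map fun u => (u, Fin.elim0)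
  | t + 1, ht => P.round p ⟨t, ht⟩ (lawUpTo P p t (Nat.le_of_succ_le ht))

/-- The law of the transcript `(U, Y_1, …, Y_n)` when the samples are i.i.d. with law `p`. -/
def transcriptLaw (P : SeqProtocol n 𝒳 𝒴 𝒰 𝒱) (p : Measure 𝒳) : Measure (𝒰 × (Fin n → 𝒴)) :=
  P.lawUpTo p n le_rfl

/-- The law of the messages `(Y_1, …, Y_n)` when the samples are i.i.d. with law `p`. -/
def messageLaw (P : SeqProtocol n 𝒳 𝒴 𝒰 𝒱) (p : Measure 𝒳) : Measure (Fin n → 𝒴) :=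
  (P.transcriptLaw p).map Prod.snd

theorem measurable_append (t : ℕ) (𝒟 : Type*) [MeasurableSpace 𝒟] :
    Measurable fun r : ((𝒰 × (Fin t → 𝒴)) × 𝒟) × 𝒴 =>
      (r.1.1.1, (Fin.snoc r.1.1.2 r.2 : Fin (t + 1) → 𝒴)) := by
  refine Measurable.prodMk (by fun_prop) (measurable_pi_iff.2 fun j => ?_)
  refine Fin.lastCases ?_ (fun i => ?_) j
  · simpa using measurable_snd
  · simp only [Fin.snoc_castSucc]
    fun_prop

instance isProbabilityMeasure_round (P : SeqProtocol n 𝒳 𝒴 𝒰 𝒱) (p : Measure 𝒳)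
    [IsProbabilityMeasure p] (t : Fin n) (ν : Measure (𝒰 × (Fin t → 𝒴)))
    [IsProbabilityMeasure ν] : IsProbabilityMeasure (P.round p t ν) :=
  Measure.isProbabilityMeasure_map (measurable_append _ _).aemeasurable

instance isProbabilityMeasure_lawUpTo (P : SeqProtocol n 𝒳 𝒴 𝒰 𝒱) (p : Measure 𝒳)
    [IsProbabilityMeasure p] (t : ℕ) (ht : t ≤ n) : IsProbabilityMeasure (P.lawUpTo p t ht) := by
  induction t with
  | zero =>
    exact Measure.isProbabilityMeasure_map (by fun_prop)
  | succ t ih =>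
    have := ih (Nat.le_of_succ_le ht)
    exact isProbabilityMeasure_round P p ⟨t, ht⟩ _

end SeqProtocol

end LocalInference

end

/-!
# Local privacy bounds the average discrepancy of interactive transcripts

Fix `z`, let `μ` be the law of the transcript under `p_z` and let `L` be the likelihood ratio of the
transcript under a neighbour `p_{z^{⊕i}}` with respect to `μ`. The *energy* `∫ (1 - L)⁺² dμ`
dominates the square of the total variation distance, which is `∫ (1 - L)⁺ dμ`
(`tvDist_sq_le_energy`). A new message multiplies `L` by a factor `1 + ξ ≥ 0` such that `ξ` has
conditional mean `0` given the past, and the elementary inequality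
`(1 - L (1 + ξ))⁺² ≤ (1 - L)⁺² - 2 L (1 - L)⁺ ξ + ξ²` (`sq_max_zero_step`) shows that the energy grows
in each round by at most the second moment of `ξ` under `μ` (`energy_step_le`). All expectations are
taken under the single law `μ`, whichever coordinate `i` is flipped, so the bounds for the `k`
neighbours can be added round by round.

In one round, `ξ_i` is the conditional mean of `α_{z,i} φ_{z,i}(X)` given the transcript. No densities
of the channels are needed: local privacy says that the joint law of (transcript, sample) and the
product of its marginals dominate each other up to the factor `e^ε` (`SeqProtocol.jointLaw_le`,
`SeqProtocol.prod_le_jointLaw`), hence there is a density `w` with values in `[e^{-ε}, e^ε]`, and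
`ξ_i(s) = α_{z,i} ∫ φ_{z,i} w(s, ·) dp_z`. Since the `φ_{z,i}` are orthonormal, and the
`α_{z,i} φ_{z,i}` have mean `0`, Bessel's inequality bounds `∑_i ξ_i²` by `α² ∫ w²` and by
`α² ∫ (w - 1)²`, hence by `α² min((e^ε - 1)², e^ε)` (`sum_sq_condMean_le`). Altogether
`∑_i d_TV² ≤ n α² min((e^ε - 1)², e^ε)` for each `z`
(`SeqProtocol.sum_tvDist_sq_transcriptLaw_le`).

Finally, `Z` given `Z_i = -1` is distributed as `Z^{⊕i}` given `Z_i = +1`, so convexity passes from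
the neighbouring pairs to the mixtures. The distance of `p_z` and `p_{z^{⊕i}}` does not depend on
`z_i`, so its mean square given `Z_i = +1` equals the unconditional one, and the sum over `i` can be
taken inside one expectation over `Z`, for every `τ` (`avgDiscrepancy_sq_le`). The messages are a
function of the transcript, hence their distances are not larger (`tvDist_map_le`).
-/

namespace LocalInference

/-! ### Bessel's inequality -/

/-- Bessel's inequality for a family that is orthonormal with respect to `p`, in terms of integrals of
functions. -/
theorem sum_sq_integral_mul_le {ι X : Type*} [Fintype ι] [DecidableEq ι] [MeasurableSpace X]
    {p : Measure X} {φ : ι → X → ℝ} (hφ : ∀ i, MemLp (φ i) 2 p)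
    (horth : ∀ i j, ∫ x, φ i x * φ j x ∂p = if i = j then 1 else 0)
    {f : X → ℝ} (hf : MemLp f 2 p) :
    ∑ i, (∫ x, φ i x * f x ∂p) ^ 2 ≤ ∫ x, f x ^ 2 ∂p := by
  set c : ι → ℝ := fun i => ∫ x, φ i x * f x ∂p
  have hff : Integrable (fun x => f x ^ 2) p := hf.integrable_sq
  have hφf : ∀ i, Integrable (fun x => φ i x * f x) p := fun i => (hφ i).integrable_mul hf
  have hφφ : ∀ i j, Integrable (fun x => φ i x * φ j x) p := fun i j =>
    (hφ i).integrable_mul (hφ j)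
  have h0 : 0 ≤ ∫ x, (f x - ∑ i, c i * φ i x) ^ 2 ∂p := integral_nonneg fun x => sq_nonneg _
  have h1 : ∀ x, (f x - ∑ i, c i * φ i x) ^ 2 = f x ^ 2 - 2 * ∑ i, c i * (φ i x * f x)
      + ∑ i, ∑ j, c i * c j * (φ i x * φ j x) := by
    intro x
    have h2 : ∑ i, ∑ j, c i * c j * (φ i x * φ j x) = (∑ i, c i * φ i x) ^ 2 := by
      rw [sq, Finset.sum_mul_sum]
      exact Finset.sum_congr rfl fun i _ => Finset.sum_congr rfl fun j _ => by ring
    have h3 : ∑ i, c i * (φ i x * f x) = (∑ i, c i * φ i x) * f x := by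
      rw [Finset.sum_mul]
      exact Finset.sum_congr rfl fun i _ => by ring
    rw [h2, h3]
    ring
  have i2 : Integrable (fun x => ∑ i, c i * (φ i x * f x)) p :=
    integrable_finsetSum _ fun i _ => (hφf i).const_mul _
  have i3 : ∀ i, Integrable (fun x => ∑ j, c i * c j * (φ i x * φ j x)) p := fun i =>
    integrable_finsetSum _ fun j _ => (hφφ i j).const_mul _
  have i4 : Integrable (fun x => f x ^ 2 - 2 * ∑ i, c i * (φ i x * f x)) p :=
    hff.sub (i2.const_mul 2)
  simp_rw [h1] at h0
  rw [integral_add i4 (integrable_finsetSum _ fun i _ => i3 i),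
    integral_sub hff (i2.const_mul 2), integral_const_mul,
    integral_finsetSum _ (fun i _ => (hφf i).const_mul _),
    integral_finsetSum _ (fun i _ => i3 i)] at h0
  have h4 : ∀ i, ∫ x, ∑ j, c i * c j * (φ i x * φ j x) ∂p = c i ^ 2 := by
    intro i
    rw [integral_finsetSum _ (fun j _ => (hφφ i j).const_mul _)]
    simp [integral_const_mul, horth, sq]
  simp_rw [h4, integral_const_mul] at h0
  have h5 : ∑ i, c i * c i = ∑ i, c i ^ 2 := Finset.sum_congr rfl fun i _ => by ring
  change 0 ≤ ∫ x, f x ^ 2 ∂p - 2 * ∑ i, c i * c i + ∑ i, c i ^ 2 at h0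
  rw [h5] at h0
  linarith

/-! ### Densities with respect to a dominating product measure -/

/-- Two finite measures that dominate each other up to the factor `e^ε` have a density that lies
everywhere (not only almost everywhere) between `e^{-ε}` and `e^ε`. -/
theorem exists_density_mem_Icc {Ω : Type*} [MeasurableSpace Ω] {J N : Measure Ω}
    [IsFiniteMeasure J] [IsFiniteMeasure N] {ε : ℝ} (hε : 0 ≤ ε)
    (hJN : J ≤ ENNReal.ofReal (Real.exp ε) • N) (hNJ : N ≤ ENNReal.ofReal (Real.exp ε) • J) :
    ∃ w : Ω → ℝ, Measurable w ∧ (∀ q, Real.exp (-ε) ≤ w q) ∧ (∀ q, w q ≤ Real.exp ε) ∧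
      J = N.withDensity fun q => ENNReal.ofReal (w q) := by
  have hac : J ≪ N := (Measure.absolutelyContinuous_of_le hJN).trans
    (Measure.smul_absolutelyContinuous)
  have hup : ∀ᵐ q ∂N, J.rnDeriv N q ≤ ENNReal.ofReal (Real.exp ε) := by
    refine ae_le_of_forall_setLIntegral_le_of_sigmaFinite (Measure.measurable_rnDeriv _ _)
      fun s hs _ => ?_
    rw [Measure.setLIntegral_rnDeriv hac, setLIntegral_const]
    simpa using hJN s
  have hlow : ∀ᵐ q ∂N, 1 ≤ ENNReal.ofReal (Real.exp ε) * J.rnDeriv N q := by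
    refine ae_le_of_forall_setLIntegral_le_of_sigmaFinite measurable_const fun s _ _ => ?_
    rw [lintegral_const_mul _ (Measure.measurable_rnDeriv _ _),
      Measure.setLIntegral_rnDeriv hac, setLIntegral_const, one_mul]
    simpa using hNJ s
  have hmm : Real.exp (-ε) ≤ Real.exp ε := Real.exp_le_exp.2 (by linarith)
  refine ⟨fun q => max (Real.exp (-ε)) (min (Real.exp ε) (J.rnDeriv N q).toReal), by fun_prop,
    fun q => le_max_left _ _, fun q => max_le hmm (min_le_left _ _), ?_⟩
  conv_lhs => rw [← Measure.withDensity_rnDeriv_eq J N hac]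
  refine withDensity_congr_ae ?_
  filter_upwards [hup, hlow] with q h1 h2
  have hfin : J.rnDeriv N q ≠ ⊤ := (h1.trans_lt ENNReal.ofReal_lt_top).ne
  have h1' : (J.rnDeriv N q).toReal ≤ Real.exp ε :=
    ENNReal.toReal_le_of_le_ofReal (Real.exp_pos _).le h1
  have h2' : Real.exp (-ε) ≤ (J.rnDeriv N q).toReal := by
    have := ENNReal.toReal_mono (ENNReal.mul_ne_top ENNReal.ofReal_ne_top hfin) h2
    rw [ENNReal.toReal_mul, ENNReal.toReal_ofReal (Real.exp_pos _).le] at this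
    rw [Real.exp_neg, inv_le_iff_one_le_mul₀' (Real.exp_pos _)]
    simpa using this
  rw [min_eq_right h1', max_eq_right h2', ENNReal.ofReal_toReal hfin]

/-! ### Conditional expectations through a density -/

theorem integrable_mul_density {S X : Type*} [MeasurableSpace S] [MeasurableSpace X] {p : Measure X}
    {w : S × X → ℝ} (hw : Measurable w) {c : ℝ} (hb : ∀ q, 0 ≤ w q)
    (hc : ∀ q, w q ≤ c) {ψ : X → ℝ} (hψ : Integrable ψ p) (s : S) :
    Integrable (fun x => ψ x * w (s, x)) p :=
  hψ.mul_bdd (c := c) (hw.comp measurable_prodMk_left).aestronglyMeasurable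
    (Filter.Eventually.of_forall fun x => by
      rw [Real.norm_eq_abs, abs_of_nonneg (hb _)]; exact hc _)

section Conditional

variable {S X : Type*} [MeasurableSpace S] [MeasurableSpace X] {J : Measure (S × X)}
  [IsProbabilityMeasure J] {p : Measure X} [IsProbabilityMeasure p] {w : S × X → ℝ}

theorem integrable_of_mem_Icc (hw : Measurable w) {b c : ℝ} (hb : ∀ q, b ≤ w q)
    (hc : ∀ q, w q ≤ c) (s : S) : Integrable (fun x => w (s, x)) p :=
  Integrable.of_mem_Icc b c (hw.comp measurable_prodMk_left).aemeasurable
    (Filter.Eventually.of_forall fun _ => ⟨hb _, hc _⟩)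

/-- A density with respect to `J.fst ⊗ p` is a conditional density of the second coordinate. -/
theorem ae_integral_density_eq_one (hw : Measurable w) (hb : ∀ q, 0 ≤ w q)
    (hJ : J = (J.fst.prod p).withDensity fun q => ENNReal.ofReal (w q)) :
    ∀ᵐ s ∂J.fst, ∫ x, w (s, x) ∂p = 1 := by
  have hm : Measurable fun s => ∫⁻ x, ENNReal.ofReal (w (s, x)) ∂p :=
    Measurable.lintegral_prod_right' (f := fun q => ENNReal.ofReal (w q)) (by fun_prop)
  have key : (fun s => ∫⁻ x, ENNReal.ofReal (w (s, x)) ∂p) =ᵐ[J.fst] fun _ => 1 := by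
    refine ae_eq_of_forall_setLIntegral_eq_of_sigmaFinite hm measurable_const fun A hA _ => ?_
    rw [setLIntegral_const, one_mul]
    conv_rhs => rw [Measure.fst_apply hA, hJ, withDensity_apply _ (measurable_fst hA)]
    rw [← lintegral_indicator (measurable_fst hA),
      lintegral_prod _ ((Measurable.indicator (by fun_prop) (measurable_fst hA)).aemeasurable),
      ← lintegral_indicator hA]
    refine lintegral_congr fun s => ?_
    by_cases hs : s ∈ A <;> simp [Set.indicator, hs]
  filter_upwards [key] with s hs
  rw [integral_eq_lintegral_of_nonneg_ae (Filter.Eventually.of_forall fun _ => hb _)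
    (hw.comp measurable_prodMk_left).aestronglyMeasurable]
  simp [hs]

/-- If the law `J` of `(s, x)` is reweighted by `ℓ(s) (1 + ψ(x))`, the law of `s` is reweighted by
`ℓ(s) (1 + E[ψ(x) | s])`. -/
theorem fst_withDensity_eq (hw : Measurable w) {c : ℝ} (hb : ∀ q, 0 ≤ w q)
    (hc : ∀ q, w q ≤ c) (hJ : J = (J.fst.prod p).withDensity fun q => ENNReal.ofReal (w q))
    {ℓ : S → ℝ} (hℓ : Measurable ℓ) (hℓ0 : ∀ s, 0 ≤ ℓ s) {ψ : X → ℝ} (hψm : Measurable ψ)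
    (hψ : Integrable ψ p) (hψ0 : ∀ᵐ x ∂p, 0 ≤ 1 + ψ x) :
    (J.withDensity fun q => ENNReal.ofReal (ℓ q.1 * (1 + ψ q.2))).fst =
      J.fst.withDensity fun s => ENNReal.ofReal (ℓ s * (1 + ∫ x, ψ x * w (s, x) ∂p)) := by
  ext A hA
  rw [Measure.fst_apply hA, withDensity_apply _ (measurable_fst hA), withDensity_apply _ hA,
    ← lintegral_indicator (measurable_fst hA), ← lintegral_indicator hA]
  conv_lhs => rw [hJ]
  have hm1 : Measurable fun q : S × X => ENNReal.ofReal (ℓ q.1 * (1 + ψ q.2)) := by fun_prop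
  have hm2 := hm1.indicator (measurable_fst hA)
  rw [lintegral_withDensity_eq_lintegral_mul _ (by fun_prop) hm2,
    lintegral_prod _ (Measurable.aemeasurable (by fun_prop))]
  refine lintegral_congr_ae ?_
  filter_upwards [ae_integral_density_eq_one hw hb hJ] with s hs
  by_cases hsA : s ∈ A
  swap
  · simp [Set.indicator, hsA]
  have hint : Integrable (fun x => ψ x * w (s, x)) p := integrable_mul_density hw hb hc hψ s
  have hint' : Integrable (fun x => w (s, x)) p := integrable_of_mem_Icc hw hb hc s
  have hsum : Integrable (fun x => ℓ s * (w (s, x) + ψ x * w (s, x))) p :=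
    (hint'.add hint).const_mul _
  have e1 : ∫ x, ℓ s * (w (s, x) + ψ x * w (s, x)) ∂p =
      ℓ s * (1 + ∫ x, ψ x * w (s, x) ∂p) := by
    rw [integral_const_mul, integral_add hint' hint, hs]
  rw [Set.indicator_of_mem hsA, ← e1,
    ofReal_integral_eq_lintegral_ofReal hsum]
  · refine lintegral_congr fun x => ?_
    have hmem : ((s, x) : S × X) ∈ Prod.fst ⁻¹' A := hsA
    simp only [Pi.mul_apply, Set.indicator_of_mem hmem]
    rw [← ENNReal.ofReal_mul (hb _)]
    congr 1
    ring
  · filter_upwards [hψ0] with x hx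
    have : w (s, x) + ψ x * w (s, x) = (1 + ψ x) * w (s, x) := by ring
    rw [this]
    exact mul_nonneg (hℓ0 s) (mul_nonneg hx (hb _))

/-- Bessel's inequality for the conditional means `a_i E[φ_i(x) | s] = a_i ∫ φ_i w(s, ·) dp`: the sum
of their squares is at most `α²` times `∫ w² ≤ e^ε`, and, as the `a_i φ_i` are centred, at most `α²`
times `∫ (w - 1)² ≤ (e^ε - 1)²`. -/
theorem sum_sq_condMean_le {ι : Type*} [Fintype ι] [DecidableEq ι] {φ : ι → X → ℝ}
    (hφ : ∀ i, MemLp (φ i) 2 p)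
    (horth : ∀ i j, ∫ x, φ i x * φ j x ∂p = if i = j then 1 else 0) {a : ι → ℝ} {α : ℝ}
    (ha : ∀ i, |a i| ≤ α) (hmean : ∀ i, ∫ x, a i * φ i x ∂p = 0) {ε : ℝ}
    (hw : Measurable w) (hb : ∀ q, Real.exp (-ε) ≤ w q) (hc : ∀ q, w q ≤ Real.exp ε) {s : S}
    (hs : ∫ x, w (s, x) ∂p = 1) :
    ∑ i, (∫ x, a i * φ i x * w (s, x) ∂p) ^ 2 ≤
      α ^ 2 * min ((Real.exp ε - 1) ^ 2) (Real.exp ε) := by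
  have hb0 : ∀ q, 0 ≤ w q := fun q => (Real.exp_pos _).le.trans (hb q)
  have hws : AEStronglyMeasurable (fun x => w (s, x)) p :=
    (hw.comp measurable_prodMk_left).aestronglyMeasurable
  have hwL : MemLp (fun x => w (s, x)) 2 p :=
    MemLp.of_bound hws (Real.exp ε) (Filter.Eventually.of_forall fun x => by
      rw [Real.norm_eq_abs, abs_of_nonneg (hb0 _)]; exact hc _)
  have hw1L : MemLp (fun x => w (s, x) - 1) 2 p := hwL.sub (memLp_const 1)
  have ha2 : ∀ i, a i ^ 2 ≤ α ^ 2 := fun i => sq_le_sq' (abs_le.1 (ha i)).1 (abs_le.1 (ha i)).2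
  have hstep : ∀ f : X → ℝ, MemLp f 2 p →
      (∀ i, ∫ x, a i * φ i x * w (s, x) ∂p = ∫ x, a i * φ i x * f x ∂p) →
      ∑ i, (∫ x, a i * φ i x * w (s, x) ∂p) ^ 2 ≤ α ^ 2 * ∫ x, f x ^ 2 ∂p := by
    intro f hf he
    calc ∑ i, (∫ x, a i * φ i x * w (s, x) ∂p) ^ 2
        ≤ ∑ i, α ^ 2 * (∫ x, φ i x * f x ∂p) ^ 2 := by
          refine Finset.sum_le_sum fun i _ => ?_
          rw [he i]
          simp_rw [mul_assoc]
          rw [integral_const_mul, mul_pow]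
          exact mul_le_mul_of_nonneg_right (ha2 i) (sq_nonneg _)
      _ ≤ α ^ 2 * ∫ x, f x ^ 2 ∂p := by
          rw [← Finset.mul_sum]
          exact mul_le_mul_of_nonneg_left (sum_sq_integral_mul_le hφ horth hf) (sq_nonneg _)
  rw [mul_min_of_nonneg _ _ (sq_nonneg α)]
  refine le_min ?_ ?_
  · refine (hstep _ hw1L fun i => ?_).trans
      (mul_le_mul_of_nonneg_left ?_ (sq_nonneg _))
    · have i1 : Integrable (fun x => a i * φ i x) p :=
        ((hφ i).integrable (by norm_num)).const_mul _
      have i2 : Integrable (fun x => a i * φ i x * w (s, x)) p :=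
        integrable_mul_density hw hb0 hc i1 s
      simp_rw [mul_sub, mul_one]
      rw [integral_sub i2 i1, hmean, sub_zero]
    · have hle : ∀ x, (w (s, x) - 1) ^ 2 ≤ (Real.exp ε - 1) ^ 2 := by
        intro x
        refine sq_le_sq' ?_ (by linarith [hc (s, x)])
        have h1 := Real.add_one_le_exp ε
        have h2 := Real.add_one_le_exp (-ε)
        linarith [hb (s, x)]
      calc ∫ x, (w (s, x) - 1) ^ 2 ∂p ≤ ∫ _, (Real.exp ε - 1) ^ 2 ∂p :=
            integral_mono hw1L.integrable_sq (integrable_const _) hle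
        _ = (Real.exp ε - 1) ^ 2 := by simp
  · refine (hstep _ hwL fun i => rfl).trans (mul_le_mul_of_nonneg_left ?_ (sq_nonneg _))
    calc ∫ x, w (s, x) ^ 2 ∂p ≤ ∫ x, Real.exp ε * w (s, x) ∂p := by
          refine integral_mono hwL.integrable_sq ((hwL.integrable (by norm_num)).const_mul _)
            fun x => ?_
          simp only [sq]
          exact mul_le_mul_of_nonneg_right (hc _) (hb0 _)
      _ = Real.exp ε := by rw [integral_const_mul, hs, mul_one]

end Conditional

/-! ### The energy of a likelihood ratio -/

/-- The inequality that drives the induction: when `ℓ` is multiplied by `1 + ξ`, the squared positive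
part `(1 - ℓ)⁺²` grows by at most `ξ²`, up to a term that is linear in `ξ`. -/
theorem sq_max_zero_step {ℓ ξ : ℝ} (hℓ : 0 ≤ ℓ) (hξ : 0 ≤ 1 + ξ) :
    max 0 (1 - ℓ * (1 + ξ)) ^ 2 ≤
      max 0 (1 - ℓ) ^ 2 - 2 * (ℓ * max 0 (1 - ℓ)) * ξ + ξ ^ 2 := by
  rcases le_total ℓ 1 with h | h
  · rw [max_eq_right (by linarith : 0 ≤ 1 - ℓ)]
    have h1 : max 0 (1 - ℓ * (1 + ξ)) ^ 2 ≤ (1 - ℓ * (1 + ξ)) ^ 2 := by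
      rcases le_total 0 (1 - ℓ * (1 + ξ)) with h0 | h0
      · rw [max_eq_right h0]
      · rw [max_eq_left h0]; nlinarith [sq_nonneg (1 - ℓ * (1 + ξ))]
    have h2 : ℓ ^ 2 * ξ ^ 2 ≤ 1 * ξ ^ 2 :=
      mul_le_mul_of_nonneg_right (by nlinarith) (sq_nonneg _)
    nlinarith
  · -- Here `(1 - ℓ)⁺ = 0`, and `1 - ℓ (1 + ξ) ≤ -ξ` because `(1 - ℓ) (1 + ξ) ≤ 0`.
    rw [max_eq_left (by linarith : 1 - ℓ ≤ 0)]
    have h1 : 1 - ℓ * (1 + ξ) ≤ -ξ := by nlinarith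
    rcases le_total 0 (1 - ℓ * (1 + ξ)) with h0 | h0
    · rw [max_eq_right h0]; nlinarith
    · rw [max_eq_left h0]; nlinarith [sq_nonneg ξ]

/-- The energy of a likelihood ratio `L`: the integral of the squared positive part `(1 - L)⁺²`. -/
noncomputable def energy {Ω : Type*} [MeasurableSpace Ω] (μ : Measure Ω) (L : Ω → ℝ) : ℝ :=
  ∫ q, max 0 (1 - L q) ^ 2 ∂μ

theorem max_zero_one_sub_mem {x : ℝ} (hx : 0 ≤ x) : max 0 (1 - x) ∈ Set.Icc (0 : ℝ) 1 :=
  ⟨le_max_left _ _, max_le zero_le_one (by linarith)⟩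

theorem integrable_sq_max {Ω : Type*} [MeasurableSpace Ω] {μ : Measure Ω} [IsFiniteMeasure μ]
    {L : Ω → ℝ} (hL : Measurable L) (hL0 : ∀ q, 0 ≤ L q) :
    Integrable (fun q => max 0 (1 - L q) ^ 2) μ :=
  Integrable.of_mem_Icc 0 1 (by fun_prop) (Filter.Eventually.of_forall fun q =>
    ⟨sq_nonneg _, pow_le_one₀ (max_zero_one_sub_mem (hL0 q)).1 (max_zero_one_sub_mem (hL0 q)).2⟩)

theorem tvDist_sq_le_energy {Ω : Type*} [MeasurableSpace Ω] {μ ν : Measure Ω}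
    [IsProbabilityMeasure μ] [IsProbabilityMeasure ν] {L : Ω → ℝ} (hL : Measurable L)
    (hL0 : ∀ q, 0 ≤ L q) (hν : ν = μ.withDensity fun q => ENNReal.ofReal (L q)) :
    tvDist μ ν ^ 2 ≤ energy μ L := by
  have hLi : Integrable L μ := by
    refine ⟨hL.aestronglyMeasurable, ?_⟩
    rw [hasFiniteIntegral_iff_ofReal (Filter.Eventually.of_forall hL0)]
    have : ν Set.univ < ⊤ := measure_lt_top _ _
    rwa [hν, withDensity_apply _ MeasurableSet.univ, setLIntegral_univ] at this
  have hreal : ∀ S, MeasurableSet S → ν.real S = ∫ q in S, L q ∂μ := by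
    intro S hS
    rw [Measure.real, hν, withDensity_apply _ hS,
      integral_eq_lintegral_of_nonneg_ae (Filter.Eventually.of_forall hL0)
        hL.aestronglyMeasurable.restrict]
  have hmi : Integrable (fun q => max 0 (1 - L q)) μ :=
    Integrable.of_mem_Icc 0 1 (by fun_prop)
      (Filter.Eventually.of_forall fun q => max_zero_one_sub_mem (hL0 q))
  set D := ∫ q, max 0 (1 - L q) ∂μ
  have h1 : ∀ S, MeasurableSet S → μ.real S - ν.real S ≤ D := by
    intro S hS
    have e : μ.real S = ∫ q in S, (1 : ℝ) ∂μ := by simp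
    rw [hreal S hS, e, ← integral_sub (integrable_const _) hLi.integrableOn]
    calc ∫ q in S, (1 - L q) ∂μ ≤ ∫ q in S, max 0 (1 - L q) ∂μ :=
          integral_mono ((integrable_const _).sub hLi.integrableOn) hmi.integrableOn
            fun q => le_max_right _ _
      _ ≤ D := setIntegral_le_integral hmi (Filter.Eventually.of_forall fun q => le_max_left _ _)
  have h2 : tvDist μ ν ≤ D := by
    refine ciSup_le fun S => abs_le.2 ⟨?_, h1 S.1 S.2⟩
    have := h1 S.1ᶜ S.2.compl
    rw [probReal_compl_eq_one_sub S.2, probReal_compl_eq_one_sub S.2] at this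
    linarith
  -- the Cauchy-Schwarz inequality, as the case of Bessel's inequality with the one function `1`
  have h3 : D ^ 2 ≤ energy μ L := by
    have hL2 : MemLp (fun q => max 0 (1 - L q)) 2 μ :=
      MemLp.of_bound (by fun_prop) 1 (Filter.Eventually.of_forall fun q => by
        rw [Real.norm_eq_abs, abs_of_nonneg (le_max_left _ _)]
        exact (max_zero_one_sub_mem (hL0 q)).2)
    simpa [D, energy] using sum_sq_integral_mul_le (ι := Unit) (φ := fun _ _ => 1) (p := μ)
      (fun _ => memLp_const 1) (by simp) hL2
  have h4 : 0 ≤ tvDist μ ν := Real.iSup_nonneg fun S => abs_nonneg _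
  exact (pow_le_pow_left₀ h4 h2 2).trans h3

/-! ### One step of the likelihood ratio -/

theorem abs_condMean_le {S X : Type*} [MeasurableSpace S] [MeasurableSpace X] {p : Measure X}
    {w : S × X → ℝ} {ψ : X → ℝ} (hψ : Integrable ψ p)
    (hw : Measurable w) {c : ℝ} (hb : ∀ q, 0 ≤ w q) (hc : ∀ q, w q ≤ c) (s : S) :
    |∫ x, ψ x * w (s, x) ∂p| ≤ c * ∫ x, |ψ x| ∂p := by
  calc |∫ x, ψ x * w (s, x) ∂p| ≤ ∫ x, |ψ x * w (s, x)| ∂p := abs_integral_le_integral_abs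
    _ ≤ ∫ x, c * |ψ x| ∂p := by
        refine integral_mono (integrable_mul_density hw hb hc hψ s).abs (hψ.abs.const_mul c)
          fun x => ?_
        simp only [abs_mul, abs_of_nonneg (hb _)]
        rw [mul_comm]
        exact mul_le_mul_of_nonneg_right (hc _) (abs_nonneg _)
    _ = c * ∫ x, |ψ x| ∂p := integral_const_mul _ _

section Step

variable {H S X : Type*} [MeasurableSpace H] [MeasurableSpace S] [MeasurableSpace X]
  {J : Measure (S × X)} [IsProbabilityMeasure J] {p : Measure X} [IsProbabilityMeasure p]
  {μ : Measure H} [IsProbabilityMeasure μ] {w : S × X → ℝ} {π : S → H}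

theorem measurable_condMean (hw : Measurable w) {ψ : X → ℝ} (hψm : Measurable ψ) :
    Measurable fun s => ∫ x, ψ x * w (s, x) ∂p :=
  (StronglyMeasurable.integral_prod_right' (f := fun q : S × X => ψ q.2 * w q)
    (Measurable.stronglyMeasurable (by fun_prop))).measurable

/-- The conditional mean of a centred function of `x` is orthogonal to the functions of the past
`π(s)`, of which `x` is independent. -/
theorem integral_past_mul_condMean_eq_zero (hπ : Measurable π)
    (hmarg : J.map (fun q => (π q.1, q.2)) = μ.prod p) (hw : Measurable w) {c : ℝ}
    (hb : ∀ q, 0 ≤ w q) (hc : ∀ q, w q ≤ c)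
    (hJ : J = (J.fst.prod p).withDensity fun q => ENNReal.ofReal (w q))
    {ψ : X → ℝ} (hψm : Measurable ψ) (hψ : Integrable ψ p) (hmean : ∫ x, ψ x ∂p = 0)
    {G : H → ℝ} (hG : Measurable G) (hG1 : ∀ h, |G h| ≤ 1) :
    ∫ s, G (π s) * ∫ x, ψ x * w (s, x) ∂p ∂J.fst = 0 := by
  have hint : Integrable (fun q : S × X => ψ q.2 * (G (π q.1) * w q)) (J.fst.prod p) := by
    refine Integrable.mul_bdd (c := c) (hψ.comp_snd J.fst)
      (Measurable.aestronglyMeasurable (by fun_prop)) (Filter.Eventually.of_forall fun q => ?_)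
    rw [Real.norm_eq_abs, abs_mul, abs_of_nonneg (hb q)]
    calc |G (π q.1)| * w q ≤ 1 * w q := mul_le_mul_of_nonneg_right (hG1 _) (hb q)
      _ ≤ c := by rw [one_mul]; exact hc q
  have h1 : ∫ s, G (π s) * ∫ x, ψ x * w (s, x) ∂p ∂J.fst =
      ∫ q, ψ q.2 * (G (π q.1) * w q) ∂(J.fst.prod p) := by
    rw [integral_prod _ hint]
    refine integral_congr_ae (Filter.Eventually.of_forall fun s => ?_)
    simp only
    rw [← integral_const_mul]
    exact integral_congr_ae (Filter.Eventually.of_forall fun x => by simp only; ring)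
  have h2 : ∫ q, ψ q.2 * (G (π q.1) * w q) ∂(J.fst.prod p) = ∫ q, G (π q.1) * ψ q.2 ∂J := by
    conv_rhs => rw [hJ]
    rw [integral_withDensity_eq_integral_toReal_smul (by fun_prop)
      (Filter.Eventually.of_forall fun q => ENNReal.ofReal_lt_top)]
    refine integral_congr_ae (Filter.Eventually.of_forall fun q => ?_)
    simp only [ENNReal.toReal_ofReal (hb q), smul_eq_mul]
    ring
  have h3 : ∫ q, G (π q.1) * ψ q.2 ∂J = ∫ q, G q.1 * ψ q.2 ∂(μ.prod p) := by
    rw [← hmarg, integral_map (Measurable.aemeasurable (by fun_prop))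
      (Measurable.aestronglyMeasurable (by fun_prop))]
  rw [h1, h2, h3, integral_prod_mul, hmean, mul_zero]

/-- If the likelihood ratio `ℓ` is multiplied by the conditional mean `1 + ξ` of the new factor
`1 + ψ(x)`, the energy grows by at most the second moment of `ξ`. -/
theorem energy_step_le (hπ : Measurable π)
    (hmarg : J.map (fun q => (π q.1, q.2)) = μ.prod p) (hw : Measurable w) {c : ℝ}
    (hb : ∀ q, 0 ≤ w q) (hc : ∀ q, w q ≤ c)
    (hJ : J = (J.fst.prod p).withDensity fun q => ENNReal.ofReal (w q))
    {ℓ : H → ℝ} (hℓ : Measurable ℓ) (hℓ0 : ∀ h, 0 ≤ ℓ h)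
    {ψ : X → ℝ} (hψm : Measurable ψ) (hψ : Integrable ψ p) (hmean : ∫ x, ψ x ∂p = 0)
    (hψ0 : ∀ᵐ x ∂p, 0 ≤ 1 + ψ x) :
    energy J.fst (fun s => max 0 (ℓ (π s) * (1 + ∫ x, ψ x * w (s, x) ∂p))) ≤
      energy μ ℓ + ∫ s, (∫ x, ψ x * w (s, x) ∂p) ^ 2 ∂J.fst := by
  set ξ : S → ℝ := fun s => ∫ x, ψ x * w (s, x) ∂p
  have hξm : Measurable ξ := measurable_condMean hw hψm
  have hξb : ∀ s, |ξ s| ≤ c * ∫ x, |ψ x| ∂p := abs_condMean_le hψ hw hb hc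
  set G : H → ℝ := fun h => ℓ h * max 0 (1 - ℓ h)
  have hGm : Measurable G := by fun_prop
  have hG1 : ∀ h, |G h| ≤ 1 := by
    intro h
    rw [abs_of_nonneg (mul_nonneg (hℓ0 h) (le_max_left _ _))]
    rcases le_total (ℓ h) 1 with h1 | h1
    · exact mul_le_one₀ h1 (le_max_left _ _) (max_zero_one_sub_mem (hℓ0 h)).2
    · simp [max_eq_left (by linarith : 1 - ℓ h ≤ 0)]
  have hfst : J.fst.map π = μ := by
    have := congrArg Measure.fst hmarg
    rw [Measure.fst_prod, Measure.fst, Measure.map_map measurable_fst (by fun_prop)] at this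
    rw [← this, Measure.fst, Measure.map_map hπ measurable_fst]
    rfl
  have i1 : Integrable (fun s => max 0 (1 - ℓ (π s)) ^ 2) J.fst :=
    integrable_sq_max (hℓ.comp hπ) fun s => hℓ0 _
  have iξ : Integrable ξ J.fst :=
    Integrable.of_bound hξm.aestronglyMeasurable _ (Filter.Eventually.of_forall hξb)
  have i2 : Integrable (fun s => G (π s) * ξ s) J.fst :=
    iξ.bdd_mul (c := 1) (Measurable.aestronglyMeasurable (by fun_prop))
      (Filter.Eventually.of_forall fun s => hG1 _)
  have i3 : Integrable (fun s => ξ s ^ 2) J.fst :=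
    (MemLp.of_bound hξm.aestronglyMeasurable _ (Filter.Eventually.of_forall hξb) :
      MemLp ξ 2 J.fst).integrable_sq
  have i12 : Integrable (fun s => max 0 (1 - ℓ (π s)) ^ 2 - 2 * (G (π s) * ξ s)) J.fst :=
    i1.sub (i2.const_mul 2)
  have hpt : ∀ᵐ s ∂J.fst, max 0 (1 - max 0 (ℓ (π s) * (1 + ξ s))) ^ 2 ≤
      max 0 (1 - ℓ (π s)) ^ 2 - 2 * (G (π s) * ξ s) + ξ s ^ 2 := by
    filter_upwards [ae_integral_density_eq_one hw hb hJ] with s hs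
    have hξ1 : 0 ≤ 1 + ξ s := by
      have e : 1 + ξ s = ∫ x, (1 + ψ x) * w (s, x) ∂p := by
        simp_rw [add_mul, one_mul]
        rw [integral_add (integrable_of_mem_Icc hw hb hc s)
          (integrable_mul_density hw hb hc hψ s), hs]
      rw [e]
      refine integral_nonneg_of_ae ?_
      filter_upwards [hψ0] with x hx using mul_nonneg hx (hb _)
    rw [max_eq_right (mul_nonneg (hℓ0 _) hξ1)]
    have := sq_max_zero_step (hℓ0 (π s)) hξ1
    simp only [G]
    linarith
  have i0 : Integrable (fun s => max 0 (1 - max 0 (ℓ (π s) * (1 + ξ s))) ^ 2) J.fst :=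
    integrable_sq_max (by fun_prop) fun s => le_max_left _ _
  have h1 := integral_mono_ae i0 (i12.add i3) hpt
  have h2 : ∫ s, (max 0 (1 - ℓ (π s)) ^ 2 - 2 * (G (π s) * ξ s) + ξ s ^ 2) ∂J.fst =
      ∫ s, max 0 (1 - ℓ (π s)) ^ 2 ∂J.fst + ∫ s, ξ s ^ 2 ∂J.fst := by
    rw [integral_add i12 i3, integral_sub i1 (i2.const_mul 2), integral_const_mul,
      integral_past_mul_condMean_eq_zero hπ hmarg hw hb hc hJ hψm hψ hmean hGm hG1]
    ring
  have h3 : ∫ s, max 0 (1 - ℓ (π s)) ^ 2 ∂J.fst = energy μ ℓ := by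
    rw [energy, ← hfst, integral_map hπ.aemeasurable
      (Measurable.aestronglyMeasurable (by fun_prop))]
  rw [← h3]
  exact h1.trans h2.le

/-- The likelihood ratios `ℓ_i` of the past extend to likelihood ratios `ℓ'_i` of the past and the
new message, and under local privacy (encoded by the two bounds on `J`) the total energy grows by
at most `α² min((e^ε - 1)², e^ε)`. -/
theorem exists_likelihoodRatio_step {ι : Type*} [Fintype ι] [DecidableEq ι] (hπ : Measurable π)
    (hmarg : J.map (fun q => (π q.1, q.2)) = μ.prod p) {ε : ℝ} (hε : 0 ≤ ε)
    (hJN : J ≤ ENNReal.ofReal (Real.exp ε) • J.fst.prod p)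
    (hNJ : J.fst.prod p ≤ ENNReal.ofReal (Real.exp ε) • J)
    {φ : ι → X → ℝ} (hφm : ∀ i, Measurable (φ i)) (hφ : ∀ i, MemLp (φ i) 2 p)
    (horth : ∀ i j, ∫ x, φ i x * φ j x ∂p = if i = j then 1 else 0) {a : ι → ℝ} {α : ℝ}
    (ha : ∀ i, |a i| ≤ α) (hmean : ∀ i, ∫ x, a i * φ i x ∂p = 0)
    (hφ0 : ∀ i, ∀ᵐ x ∂p, 0 ≤ 1 + a i * φ i x)
    {ℓ : ι → H → ℝ} (hℓ : ∀ i, Measurable (ℓ i)) (hℓ0 : ∀ i h, 0 ≤ ℓ i h) :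
    ∃ ℓ' : ι → S → ℝ, (∀ i, Measurable (ℓ' i)) ∧ (∀ i s, 0 ≤ ℓ' i s) ∧
      (∀ i, (J.withDensity fun q => ENNReal.ofReal (ℓ i (π q.1) * (1 + a i * φ i q.2))).fst =
        J.fst.withDensity fun s => ENNReal.ofReal (ℓ' i s)) ∧
      ∑ i, energy J.fst (ℓ' i) ≤
        ∑ i, energy μ (ℓ i) + α ^ 2 * min ((Real.exp ε - 1) ^ 2) (Real.exp ε) := by
  obtain ⟨w, hw, hb, hc, hJ⟩ := exists_density_mem_Icc hε hJN hNJ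
  have hb0 : ∀ q, 0 ≤ w q := fun q => (Real.exp_pos _).le.trans (hb q)
  have hψm : ∀ i, Measurable fun x => a i * φ i x := fun i => (hφm i).const_mul _
  have hψ : ∀ i, Integrable (fun x => a i * φ i x) p := fun i =>
    ((hφ i).integrable (by norm_num)).const_mul _
  have hξm : ∀ i, Measurable fun s => ∫ x, a i * φ i x * w (s, x) ∂p := fun i =>
    measurable_condMean hw (hψm i)
  refine ⟨fun i s => max 0 (ℓ i (π s) * (1 + ∫ x, a i * φ i x * w (s, x) ∂p)),
    fun i => ?_, fun i s => le_max_left _ _, fun i => ?_, ?_⟩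
  · have := hξm i
    have := (hℓ i).comp hπ
    fun_prop
  · refine (fst_withDensity_eq hw hb0 hc hJ (ℓ := fun s => ℓ i (π s)) ((hℓ i).comp hπ)
      (fun s => hℓ0 i _) (hψm i) (hψ i) (hφ0 i)).trans ?_
    refine congrArg _ (funext fun s => ?_)
    dsimp only
    rcases le_total 0 (ℓ i (π s) * (1 + ∫ x, a i * φ i x * w (s, x) ∂p)) with h | h
    · rw [max_eq_right h]
    · rw [max_eq_left h, ENNReal.ofReal_of_nonpos h, ENNReal.ofReal_zero]
  · calc _ ≤ ∑ i, (energy μ (ℓ i) + ∫ s, (∫ x, a i * φ i x * w (s, x) ∂p) ^ 2 ∂J.fst) :=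
          Finset.sum_le_sum fun i _ => energy_step_le hπ hmarg hw hb0 hc hJ (hℓ i) (hℓ0 i)
            (hψm i) (hψ i) (hmean i) (hφ0 i)
      _ = ∑ i, energy μ (ℓ i) + ∫ s, ∑ i, (∫ x, a i * φ i x * w (s, x) ∂p) ^ 2 ∂J.fst := by
          rw [Finset.sum_add_distrib, integral_finsetSum]
          intro i _
          exact (MemLp.of_bound (hξm i).aestronglyMeasurable _ (Filter.Eventually.of_forall
            (abs_condMean_le (hψ i) hw hb0 hc)) : MemLp _ 2 J.fst).integrable_sq
      _ ≤ _ := by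
          refine add_le_add_right ?_ _
          calc ∫ s, ∑ i, (∫ x, a i * φ i x * w (s, x) ∂p) ^ 2 ∂J.fst
              ≤ ∫ _, α ^ 2 * min ((Real.exp ε - 1) ^ 2) (Real.exp ε) ∂J.fst := by
                refine integral_mono_of_nonneg (Filter.Eventually.of_forall fun s =>
                  Finset.sum_nonneg fun i _ => sq_nonneg _) (integrable_const _) ?_
                filter_upwards [ae_integral_density_eq_one hw hb0 hJ] with s hs
                exact sum_sq_condMean_le hφ horth ha hmean hw hb hc hs
            _ = _ := by simp

end Step

/-! ### The joint law of the messages and of the last sample -/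

/-- If `T` retains the value of the density `g` of the first coordinate, reweighting by `g` before the
kernel amounts to reweighting the image under `T`. -/
theorem withDensity_compProd_map {A B C : Type*} [MeasurableSpace A] [MeasurableSpace B]
    [MeasurableSpace C] {M : Measure A} [SFinite M] {K : Kernel A B} [IsSFiniteKernel K]
    {T : A × B → C} (hT : Measurable T) {g : A → ENNReal} (hg : Measurable g)
    [SFinite (M.withDensity g)] {f : C → ENNReal}
    (hf : Measurable f) (hfg : ∀ r, f (T r) = g r.1) :
    ((M.withDensity g) ⊗ₘ K).map T = ((M ⊗ₘ K).map T).withDensity f := by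
  ext s hs
  have hTs : MeasurableSet (T ⁻¹' s) := hT hs
  rw [Measure.map_apply hT hs, Measure.compProd_apply hTs, withDensity_apply _ hs,
    ← lintegral_indicator hs, lintegral_map (hf.indicator hs) hT,
    Measure.lintegral_compProd (f := fun q => s.indicator f (T q)) ((hf.indicator hs).comp hT),
    lintegral_withDensity_eq_lintegral_mul _ hg (Kernel.measurable_kernel_prodMk_left hTs)]
  refine lintegral_congr fun r => ?_
  have e : ∀ b, s.indicator f (T (r, b)) =
      g r * (Prod.mk r ⁻¹' (T ⁻¹' s)).indicator (fun _ => 1) b := by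
    intro b
    by_cases h : T (r, b) ∈ s <;> simp [h, hfg]
  simp_rw [e]
  rw [lintegral_const_mul _ (measurable_const.indicator (measurable_prodMk_left hTs)),
    lintegral_indicator_const (measurable_prodMk_left hTs), one_mul, Pi.mul_apply]

namespace SeqProtocol

variable {n : ℕ} {𝒳 𝒴 𝒰 : Type*} {𝒱 : Fin n → Type*} [MeasurableSpace 𝒳]
    [MeasurableSpace 𝒴] [MeasurableSpace 𝒰] [∀ t, MeasurableSpace (𝒱 t)]

/-- The joint law, after round `t`, of the public randomness with the messages and of the sample
of player `t`. Its first marginal is `P.round p t ν`. -/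
noncomputable def jointLaw (P : SeqProtocol n 𝒳 𝒴 𝒰 𝒱) (p : Measure 𝒳) (t : Fin n)
    (ν : Measure (𝒰 × (Fin t → 𝒴))) : Measure ((𝒰 × (Fin (t + 1) → 𝒴)) × 𝒳) :=
  ((ν.prod ((P.priv t).prod p)) ⊗ₘ P.roundKernel t).map
    fun r => ((r.1.1.1, (Fin.snoc r.1.1.2 r.2 : Fin (t + 1) → 𝒴)), r.1.2.2)

theorem measurable_append_sample (t : ℕ) (𝒟 : Type*) [MeasurableSpace 𝒟] :
    Measurable fun r : ((𝒰 × (Fin t → 𝒴)) × (𝒟 × 𝒳)) × 𝒴 =>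
      ((r.1.1.1, (Fin.snoc r.1.1.2 r.2 : Fin (t + 1) → 𝒴)), r.1.2.2) :=
  (measurable_append t (𝒟 × 𝒳)).prodMk (by fun_prop)

theorem fst_jointLaw (P : SeqProtocol n 𝒳 𝒴 𝒰 𝒱) (p : Measure 𝒳) (t : Fin n)
    (ν : Measure (𝒰 × (Fin t → 𝒴))) : (P.jointLaw p t ν).fst = P.round p t ν := by
  rw [Measure.fst, jointLaw, Measure.map_map measurable_fst (measurable_append_sample _ _)]
  rfl

/-- The past: the public randomness and all messages but the last. -/
def past (t : ℕ) (s : 𝒰 × (Fin (t + 1) → 𝒴)) : 𝒰 × (Fin t → 𝒴) := (s.1, Fin.init s.2)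

theorem measurable_past (t : ℕ) : Measurable (past t : 𝒰 × (Fin (t + 1) → 𝒴) → _) :=
  measurable_fst.prodMk (measurable_pi_iff.2 fun j =>
    (measurable_pi_apply (Fin.castSucc j)).comp measurable_snd)

variable (P : SeqProtocol n 𝒳 𝒴 𝒰 𝒱) (p : Measure 𝒳) [IsProbabilityMeasure p] (t : Fin n)
  (ν : Measure (𝒰 × (Fin t → 𝒴))) [IsProbabilityMeasure ν]

instance isProbabilityMeasure_jointLaw : IsProbabilityMeasure (P.jointLaw p t ν) :=
  Measure.isProbabilityMeasure_map (measurable_append_sample _ _).aemeasurable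

theorem jointLaw_map_past :
    (P.jointLaw p t ν).map (fun q => (past t q.1, q.2)) = ν.prod p := by
  have h1 : Measurable fun q : (𝒰 × (Fin (t + 1) → 𝒴)) × 𝒳 => (past (t : ℕ) q.1, q.2) :=
    ((measurable_past _).comp measurable_fst).prodMk measurable_snd
  have h2 : (fun q : (𝒰 × (Fin (t + 1) → 𝒴)) × 𝒳 => (past (t : ℕ) q.1, q.2)) ∘
      (fun r : ((𝒰 × (Fin t → 𝒴)) × (𝒱 t × 𝒳)) × 𝒴 =>
        ((r.1.1.1, (Fin.snoc r.1.1.2 r.2 : Fin (t + 1) → 𝒴)), r.1.2.2)) =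
      Prod.map id Prod.snd ∘ Prod.fst := by
    funext r
    simp [past, Prod.map]
  rw [jointLaw, Measure.map_map h1 (measurable_append_sample _ _), h2,
    ← Measure.map_map (by fun_prop) measurable_fst]
  change Measure.map _ (Measure.fst _) = _
  rw [Measure.fst_compProd, ← Measure.map_prod_map _ _ measurable_id measurable_snd,
    Measure.map_id, ← Measure.snd, Measure.snd_prod]

/-- A round played with the past reweighted by `ℓ` and the sample reweighted by `D` yields the first
marginal of the joint law reweighted by the product. -/
theorem round_withDensity {ℓ : 𝒰 × (Fin t → 𝒴) → ℝ} (hℓ : Measurable ℓ) (hℓ0 : ∀ h, 0 ≤ ℓ h)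
    {D : 𝒳 → ℝ} (hD : Measurable D)
    [IsProbabilityMeasure (ν.withDensity fun h => ENNReal.ofReal (ℓ h))]
    [IsProbabilityMeasure (p.withDensity fun x => ENNReal.ofReal (D x))] :
    P.round (p.withDensity fun x => ENNReal.ofReal (D x)) t
        (ν.withDensity fun h => ENNReal.ofReal (ℓ h)) =
      ((P.jointLaw p t ν).withDensity fun q =>
        ENNReal.ofReal (ℓ (past t q.1) * D q.2)).fst := by
  rw [← fst_jointLaw]
  congr 1
  have hprod : (ν.withDensity fun h => ENNReal.ofReal (ℓ h)).prod
      ((P.priv t).prod (p.withDensity fun x => ENNReal.ofReal (D x))) =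
      (ν.prod ((P.priv t).prod p)).withDensity
        fun r => ENNReal.ofReal (ℓ r.1 * D r.2.2) := by
    rw [prod_withDensity_right (by fun_prop), prod_withDensity (by fun_prop) (by fun_prop)]
    simp_rw [ENNReal.ofReal_mul (hℓ0 _)]
  have : SFinite ((ν.prod ((P.priv t).prod p)).withDensity
      fun r => ENNReal.ofReal (ℓ r.1 * D r.2.2)) := by
    rw [← hprod]
    infer_instance
  have hpast := measurable_past (𝒰 := 𝒰) (𝒴 := 𝒴) t
  rw [jointLaw, hprod]
  refine withDensity_compProd_map (measurable_append_sample _ _) (by fun_prop) (by fun_prop)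
    fun r => ?_
  simp [past]

/-- The probability that the sample `x'` and the past `h`, followed by the message of player `t`
with private randomness `v` and sample `x`, belong to `C`. -/
noncomputable def sectionProb (C : Set ((𝒰 × (Fin (t + 1) → 𝒴)) × 𝒳)) (h : 𝒰 × (Fin t → 𝒴))
    (v : 𝒱 t) (x x' : 𝒳) : ENNReal :=
  P.roundKernel t (h, (v, x)) {y | ((h.1, (Fin.snoc h.2 y : Fin (t + 1) → 𝒴)), x') ∈ C}

theorem measurable_sectionProb {C : Set ((𝒰 × (Fin (t + 1) → 𝒴)) × 𝒳)} (hC : MeasurableSet C) :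
    Measurable fun q : ((𝒰 × (Fin t → 𝒴)) × 𝒱 t) × (𝒳 × 𝒳) =>
      P.sectionProb t C q.1.1 q.1.2 q.2.1 q.2.2 := by
  have hT : Measurable fun r : (((𝒰 × (Fin t → 𝒴)) × 𝒱 t) × (𝒳 × 𝒳)) × 𝒴 =>
      ((r.1.1.1.1, (Fin.snoc r.1.1.1.2 r.2 : Fin (t + 1) → 𝒴)), r.1.2.2) :=
    (measurable_append_sample (t : ℕ) (𝒱 t × 𝒳)).comp
      (f := fun r : (((𝒰 × (Fin t → 𝒴)) × 𝒱 t) × (𝒳 × 𝒳)) × 𝒴 =>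
        ((r.1.1.1, ((r.1.1.2, r.1.2.1), r.1.2.2)), r.2)) (by fun_prop)
  exact Kernel.measurable_kernel_prodMk_left (κ := (P.roundKernel t).comap
    (fun q : ((𝒰 × (Fin t → 𝒴)) × 𝒱 t) × (𝒳 × 𝒳) => (q.1.1, (q.1.2, q.2.1))) (by fun_prop)) (hT hC)

theorem jointLaw_apply {C : Set ((𝒰 × (Fin (t + 1) → 𝒴)) × 𝒳)} (hC : MeasurableSet C) :
    P.jointLaw p t ν C = ∫⁻ h, ∫⁻ v, ∫⁻ x', P.sectionProb t C h v x' x' ∂p ∂(P.priv t) ∂ν := by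
  have hTC := measurable_append_sample (𝒰 := 𝒰) (𝒴 := 𝒴) (t : ℕ) (𝒱 t) hC
  rw [jointLaw, Measure.map_apply (measurable_append_sample _ _) hC, Measure.compProd_apply hTC,
    lintegral_prod _ (Kernel.measurable_kernel_prodMk_left hTC).aemeasurable]
  refine lintegral_congr fun h => ?_
  rw [lintegral_prod _ (Measurable.aemeasurable
    (f := fun q => P.roundKernel t (h, q) (Prod.mk (h, q) ⁻¹' (_ ⁻¹' C)))
    ((Kernel.measurable_kernel_prodMk_left hTC).comp measurable_prodMk_left))]
  rfl

theorem round_prod_apply {C : Set ((𝒰 × (Fin (t + 1) → 𝒴)) × 𝒳)} (hC : MeasurableSet C) :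
    ((P.round p t ν).prod p) C =
      ∫⁻ h, ∫⁻ v, ∫⁻ x', ∫⁻ x, P.sectionProb t C h v x x' ∂p ∂p ∂(P.priv t) ∂ν := by
  have hm := P.measurable_sectionProb t hC
  have h1 : ∀ x', P.round p t ν ((fun s => (s, x')) ⁻¹' C) =
      ∫⁻ h, ∫⁻ v, ∫⁻ x, P.sectionProb t C h v x x' ∂p ∂(P.priv t) ∂ν := by
    intro x'
    have hC' : MeasurableSet ((fun s => (s, x')) ⁻¹' C) := measurable_prodMk_right hC
    rw [← fst_jointLaw, Measure.fst_apply hC', jointLaw_apply _ _ _ _ (measurable_fst hC')]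
    rfl
  rw [Measure.prod_apply_symm hC]
  simp_rw [h1]
  have hm3 : Measurable fun q : ((𝒰 × (Fin t → 𝒴)) × 𝒱 t) × 𝒳 =>
      ∫⁻ x, P.sectionProb t C q.1.1 q.1.2 x q.2 ∂p :=
    Measurable.lintegral_prod_right' (f := fun r : (((𝒰 × (Fin t → 𝒴)) × 𝒱 t) × 𝒳) × 𝒳 =>
      P.sectionProb t C r.1.1.1 r.1.1.2 r.2 r.1.2)
      (hm.comp (f := fun r : (((𝒰 × (Fin t → 𝒴)) × 𝒱 t) × 𝒳) × 𝒳 =>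
        (r.1.1, (r.2, r.1.2))) (by fun_prop))
  have hm2 : Measurable fun q : 𝒳 × (𝒰 × (Fin t → 𝒴)) =>
      ∫⁻ v, ∫⁻ x, P.sectionProb t C q.2 v x q.1 ∂p ∂(P.priv t) :=
    Measurable.lintegral_prod_right' (f := fun r : (𝒳 × (𝒰 × (Fin t → 𝒴))) × 𝒱 t =>
      ∫⁻ x, P.sectionProb t C r.1.2 r.2 x r.1.1 ∂p)
      (hm3.comp (f := fun r : (𝒳 × (𝒰 × (Fin t → 𝒴))) × 𝒱 t => ((r.1.2, r.2), r.1.1))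
        (by fun_prop))
  rw [lintegral_lintegral_swap hm2.aemeasurable]
  refine lintegral_congr fun h => ?_
  rw [lintegral_lintegral_swap]
  exact (hm3.comp (f := fun r : 𝒳 × 𝒱 t => ((h, r.2), r.1)) (by fun_prop)).aemeasurable

theorem sectionProb_le {ε : ℝ} (hP : P.Uses fun t => ldpChannels 𝒳 (Fin t → 𝒴) 𝒴 ε)
    {C : Set ((𝒰 × (Fin (t + 1) → 𝒴)) × 𝒳)} (hC : MeasurableSet C)
    (h : 𝒰 × (Fin t → 𝒴)) (v : 𝒱 t) (x₁ x₂ x' : 𝒳) :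
    P.sectionProb t C h v x₁ x' ≤ ENNReal.ofReal (Real.exp ε) * P.sectionProb t C h v x₂ x' := by
  refine (hP t h.1 v).2 h.2 x₁ x₂ _ ?_
  exact ((measurable_append_sample (t : ℕ) (𝒱 t)).comp
    (measurable_prodMk_left (x := (h, (v, x'))))) hC

/-- Local privacy makes the last sample almost independent of the messages: the joint law and the
product of its marginals dominate each other up to the factor `e^ε`. -/
theorem jointLaw_le {ε : ℝ} (hP : P.Uses fun t => ldpChannels 𝒳 (Fin t → 𝒴) 𝒴 ε) :
    P.jointLaw p t ν ≤ ENNReal.ofReal (Real.exp ε) • (P.jointLaw p t ν).fst.prod p := by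
  refine Measure.le_iff.2 fun C hC => ?_
  rw [fst_jointLaw, Measure.smul_apply, smul_eq_mul, jointLaw_apply _ _ _ _ hC,
    round_prod_apply _ _ _ _ hC]
  simp_rw [← lintegral_const_mul' _ _ ENNReal.ofReal_ne_top]
  gcongr with h v x'
  calc P.sectionProb t C h v x' x' = ∫⁻ _, P.sectionProb t C h v x' x' ∂p := by simp
    _ ≤ _ := lintegral_mono fun x => P.sectionProb_le t hP hC h v x' x x'

theorem prod_le_jointLaw {ε : ℝ} (hP : P.Uses fun t => ldpChannels 𝒳 (Fin t → 𝒴) 𝒴 ε) :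
    (P.jointLaw p t ν).fst.prod p ≤ ENNReal.ofReal (Real.exp ε) • P.jointLaw p t ν := by
  refine Measure.le_iff.2 fun C hC => ?_
  rw [fst_jointLaw, Measure.smul_apply, smul_eq_mul, jointLaw_apply _ _ _ _ hC,
    round_prod_apply _ _ _ _ hC]
  simp_rw [← lintegral_const_mul' _ _ ENNReal.ofReal_ne_top]
  gcongr with h v x'
  calc ∫⁻ x, P.sectionProb t C h v x x' ∂p
      ≤ ∫⁻ _, ENNReal.ofReal (Real.exp ε) * P.sectionProb t C h v x' x' ∂p :=
        lintegral_mono fun x => P.sectionProb_le t hP hC h v x x' x'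
    _ = _ := by simp

/-! ### Likelihood ratios of the transcripts -/

/-- The transcript under the perturbed laws `q_i = (1 + a_i φ_i) p` has likelihood ratios with
respect to the transcript under `p` whose energies add up to at most
`α² min((e^ε - 1)², e^ε)` per round. -/
theorem exists_likelihoodRatio {ι : Type*} [Fintype ι] [DecidableEq ι] {ε : ℝ} (hε : 0 ≤ ε)
    (hP : P.Uses fun t => ldpChannels 𝒳 (Fin t → 𝒴) 𝒴 ε)
    {φ : ι → 𝒳 → ℝ} (hφm : ∀ i, Measurable (φ i)) (hφ : ∀ i, MemLp (φ i) 2 p)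
    (horth : ∀ i j, ∫ x, φ i x * φ j x ∂p = if i = j then 1 else 0) {a : ι → ℝ} {α : ℝ}
    (ha : ∀ i, |a i| ≤ α) (hφ0 : ∀ i, ∀ᵐ x ∂p, 0 ≤ 1 + a i * φ i x)
    {q : ι → Measure 𝒳} [∀ i, IsProbabilityMeasure (q i)]
    (hq : ∀ i, q i = p.withDensity fun x => ENNReal.ofReal (1 + a i * φ i x))
    (t : ℕ) (ht : t ≤ n) :
    ∃ ℓ : ι → 𝒰 × (Fin t → 𝒴) → ℝ, (∀ i, Measurable (ℓ i)) ∧ (∀ i h, 0 ≤ ℓ i h) ∧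
      (∀ i, P.lawUpTo (q i) t ht =
        (P.lawUpTo p t ht).withDensity fun h => ENNReal.ofReal (ℓ i h)) ∧
      ∑ i, energy (P.lawUpTo p t ht) (ℓ i) ≤
        t * (α ^ 2 * min ((Real.exp ε - 1) ^ 2) (Real.exp ε)) := by
  have hmean : ∀ i, ∫ x, a i * φ i x ∂p = 0 := by
    intro i
    have hi : Integrable (fun x => a i * φ i x) p :=
      ((hφ i).integrable (by norm_num)).const_mul _
    have hi' : Integrable (fun x => 1 + a i * φ i x) p := (integrable_const 1).add hi
    have h1 : q i Set.univ = 1 := measure_univ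
    rw [hq, withDensity_apply _ MeasurableSet.univ, setLIntegral_univ,
      ← ofReal_integral_eq_lintegral_ofReal hi' (hφ0 i),
      ENNReal.ofReal_eq_one, integral_add (integrable_const 1) hi] at h1
    simpa using h1
  induction t with
  | zero =>
    refine ⟨fun _ _ => 1, fun _ => measurable_const, fun _ _ => zero_le_one, fun i => ?_, ?_⟩
    · simp [lawUpTo]
    · simp [energy]
  | succ t ih =>
    obtain ⟨ℓ, hℓ, hℓ0, hℓq, hE⟩ := ih (Nat.le_of_succ_le ht)
    obtain ⟨ℓ', hℓ', hℓ0', hℓq', hE'⟩ := exists_likelihoodRatio_step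
      (J := P.jointLaw p ⟨t, ht⟩ (P.lawUpTo p t (Nat.le_of_succ_le ht)))
      (measurable_past t) (P.jointLaw_map_past p ⟨t, ht⟩ _) hε (P.jointLaw_le p ⟨t, ht⟩ _ hP)
      (P.prod_le_jointLaw p ⟨t, ht⟩ _ hP) hφm hφ horth ha hmean hφ0 hℓ hℓ0
    rw [fst_jointLaw] at hE'
    simp_rw [fst_jointLaw] at hℓq'
    refine ⟨ℓ', hℓ', hℓ0', fun i => ?_, ?_⟩
    · have i1 : IsProbabilityMeasure (p.withDensity fun x => ENNReal.ofReal (1 + a i * φ i x)) :=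
        hq i ▸ inferInstance
      have i2 : IsProbabilityMeasure ((P.lawUpTo p t (Nat.le_of_succ_le ht)).withDensity
          fun h => ENNReal.ofReal (ℓ i h)) := hℓq i ▸ inferInstance
      refine Eq.trans ?_ (hℓq' i)
      rw [lawUpTo, hℓq i, hq i]
      exact P.round_withDensity p ⟨t, ht⟩ _ (hℓ i) (hℓ0 i)
        (D := fun x => 1 + a i * φ i x) (by have := hφm i; fun_prop)
    · refine hE'.trans ?_
      push_cast
      linarith

/-- For each `z`, the total variation distances between the transcripts under `p_z` and under
its `k` neighbours satisfy `∑_i d_TV² ≤ n α² min((e^ε - 1)², e^ε)`. -/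
theorem sum_tvDist_sq_transcriptLaw_le {k : ℕ} {ε : ℝ} (hε : 0 ≤ ε)
    (hP : P.Uses fun t => ldpChannels 𝒳 (Fin t → 𝒴) 𝒴 ε)
    {p : Cube k → Measure 𝒳} (hp : ∀ z, IsProbabilityMeasure (p z)) {α : ℝ}
    {a : Cube k → Fin k → ℝ} {φ : Cube k → Fin k → 𝒳 → ℝ} (hdens : DensitiesExist p α a φ)
    (horth : IsOrthonormal p φ) (z : Cube k) :
    ∑ i, tvDist (P.transcriptLaw (p z)) (P.transcriptLaw (p (flipAt z i))) ^ 2 ≤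
      n * (α ^ 2 * min ((Real.exp ε - 1) ^ 2) (Real.exp ε)) := by
  have hφ : ∀ i, MemLp (φ z i) 2 (p z) := fun i => by
    rw [memLp_two_iff_integrable_sq (hdens.measurable z i).aestronglyMeasurable]
    -- a function that is not integrable would have integral `0`, not `1`
    refine Integrable.of_integral_ne_zero ?_
    have := horth z i i
    simp_rw [← sq] at this
    simp [this]
  have hφ0 : ∀ i, ∀ᵐ x ∂p z, 0 ≤ 1 + a z i * φ z i x := fun i => by
    filter_upwards [hdens.density z i] with x hx
    rw [← hx]
    exact ENNReal.toReal_nonneg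
  have hq : ∀ i, p (flipAt z i) =
      (p z).withDensity fun x => ENNReal.ofReal (1 + a z i * φ z i x) := fun i => by
    conv_lhs => rw [← Measure.withDensity_rnDeriv_eq _ _ (hdens.ac z i)]
    refine withDensity_congr_ae ?_
    filter_upwards [hdens.density z i, Measure.rnDeriv_lt_top (p (flipAt z i)) (p z)] with x hx hx'
    rw [← hx, ENNReal.ofReal_toReal hx'.ne]
  obtain ⟨ℓ, hℓ, hℓ0, hℓq, hE⟩ := P.exists_likelihoodRatio (p z) hε hP (hdens.measurable z) hφ
    (horth z) (hdens.abs_le z) hφ0 hq n le_rfl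
  refine (Finset.sum_le_sum fun i _ => ?_).trans hE
  exact tvDist_sq_le_energy (μ := P.lawUpTo (p z) n le_rfl)
    (ν := P.lawUpTo (p (flipAt z i)) n le_rfl) (hℓ i) (hℓ0 i) (hℓq i)

end SeqProtocol

/-! ### Total variation distance -/

section TotalVariation

variable {Ω : Type*} [MeasurableSpace Ω]

theorem tvDist_nonneg (μ ν : Measure Ω) : 0 ≤ tvDist μ ν := Real.iSup_nonneg fun _ => abs_nonneg _

theorem tvDist_comm (μ ν : Measure Ω) : tvDist μ ν = tvDist ν μ := by
  simp only [tvDist, abs_sub_comm]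

theorem abs_real_sub_le_tvDist (μ ν : Measure Ω) [IsFiniteMeasure μ] [IsFiniteMeasure ν]
    {S : Set Ω} (hS : MeasurableSet S) : |μ.real S - ν.real S| ≤ tvDist μ ν := by
  refine le_ciSup (f := fun S : {S : Set Ω // MeasurableSet S} => |μ.real S.1 - ν.real S.1|)
    ⟨μ.real Set.univ + ν.real Set.univ, ?_⟩ ⟨S, hS⟩
  rintro _ ⟨A, rfl⟩
  have h1 : μ.real A.1 ≤ μ.real Set.univ := measureReal_mono (Set.subset_univ _)
  have h2 : ν.real A.1 ≤ ν.real Set.univ := measureReal_mono (Set.subset_univ _)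
  have h3 : 0 ≤ μ.real A.1 := measureReal_nonneg
  have h4 : 0 ≤ ν.real A.1 := measureReal_nonneg
  exact abs_le.2 ⟨by linarith, by linarith⟩

theorem tvDist_map_le {Ω' : Type*} [MeasurableSpace Ω'] (μ ν : Measure Ω) [IsFiniteMeasure μ]
    [IsFiniteMeasure ν] {f : Ω → Ω'} (hf : Measurable f) :
    tvDist (μ.map f) (ν.map f) ≤ tvDist μ ν := by
  refine ciSup_le fun S => ?_
  rw [map_measureReal_apply hf S.2, map_measureReal_apply hf S.2]
  exact abs_real_sub_le_tvDist μ ν (hf S.2)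

end TotalVariation

/-! ### Mixtures over the cube -/

theorem flipAt_flipAt {k : ℕ} (z : Cube k) (i : Fin k) : flipAt (flipAt z i) i = z := by
  simp [flipAt]

/-- Flipping the `i`-th sign, as a permutation of the cube. -/
def flipEquiv {k : ℕ} (i : Fin k) : Cube k ≃ Cube k where
  toFun z := flipAt z i
  invFun z := flipAt z i
  left_inv z := flipAt_flipAt z i
  right_inv z := flipAt_flipAt z i

instance measurableSingletonClass_intUnits : MeasurableSingletonClass ℤˣ where
  measurableSet_singleton s := ⟨{(s : ℤ)}, measurableSet_singleton _, by ext; simp [Units.ext_iff]⟩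

theorem isProbabilityMeasure_rademacher {τ : ℝ} (hτ : τ ∈ Set.Ioc (0 : ℝ) (1 / 2)) :
    IsProbabilityMeasure (rademacher τ) := by
  refine ⟨?_⟩
  rw [rademacher, Measure.add_apply, Measure.smul_apply, Measure.smul_apply, measure_univ,
    measure_univ, smul_eq_mul, smul_eq_mul, mul_one, mul_one,
    ← ENNReal.ofReal_add hτ.1.le (by linarith [hτ.2])]
  simp

theorem rademacher_real_one {τ : ℝ} (hτ : τ ∈ Set.Ioc (0 : ℝ) (1 / 2)) :
    (rademacher τ).real {1} = τ := by
  have h : (-1 : ℤˣ) ≠ 1 := by decide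
  simp [Measure.real, rademacher, h, hτ.1.le]

theorem rademacher_real_neg_one {τ : ℝ} (hτ : τ ∈ Set.Ioc (0 : ℝ) (1 / 2)) :
    (rademacher τ).real {-1} = 1 - τ := by
  have h : (1 : ℤˣ) ≠ -1 := by decide
  have h' : 0 ≤ 1 - τ := by linarith [hτ.2]
  simp [Measure.real, rademacher, h, h']

theorem rademacher_real_pos {τ : ℝ} (hτ : τ ∈ Set.Ioc (0 : ℝ) (1 / 2)) (s : ℤˣ) :
    0 < (rademacher τ).real {s} := by
  rcases Int.units_eq_one_or s with rfl | rfl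
  · rw [rademacher_real_one hτ]; exact hτ.1
  · rw [rademacher_real_neg_one hτ]; linarith [hτ.2]

section Mixture

variable {k : ℕ} {τ : ℝ}

/-- The conditional probability of `{Z = z}` given `Z_i = s`, as a real number. -/
noncomputable def condWeight (τ : ℝ) (i : Fin k) (s : ℤˣ) (z : Cube k) : ℝ :=
  (cond (cubeLaw k τ) {z' | z' i = s}).real {z}

theorem isProbabilityMeasure_cubeLaw (hτ : τ ∈ Set.Ioc (0 : ℝ) (1 / 2)) :
    IsProbabilityMeasure (cubeLaw k τ) := by
  have := isProbabilityMeasure_rademacher hτ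
  unfold cubeLaw
  infer_instance

theorem cubeLaw_real_eval (hτ : τ ∈ Set.Ioc (0 : ℝ) (1 / 2)) (i : Fin k) (s : ℤˣ) :
    (cubeLaw k τ).real {z' | z' i = s} = (rademacher τ).real {s} := by
  have := isProbabilityMeasure_rademacher hτ
  have h := (measurePreserving_eval (fun _ : Fin k => rademacher τ) i).measure_preimage
    (measurableSet_singleton s).nullMeasurableSet
  rw [Measure.real, Measure.real, ← h]
  rfl

theorem condWeight_eq (hτ : τ ∈ Set.Ioc (0 : ℝ) (1 / 2)) (i : Fin k) (s : ℤˣ) (z : Cube k) :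
    condWeight τ i s z =
      if z i = s then ∏ j ∈ Finset.univ.erase i, (rademacher τ).real {z j} else 0 := by
  have := isProbabilityMeasure_rademacher hτ
  have hm : MeasurableSet {z' : Cube k | z' i = s} := Set.Finite.measurableSet (Set.toFinite _)
  rw [condWeight, Measure.real, cond_apply hm, ENNReal.toReal_mul, ENNReal.toReal_inv,
    ← Measure.real, ← Measure.real, cubeLaw_real_eval hτ]
  split_ifs with h
  · have e : {z' : Cube k | z' i = s} ∩ {z} = {z} := by
      rw [Set.inter_eq_right]; simpa using h
    have e2 : (cubeLaw k τ).real {z} = ∏ j, (rademacher τ).real {z j} := by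
      simp [Measure.real, cubeLaw, ENNReal.toReal_prod]
    rw [e, e2, ← Finset.mul_prod_erase _ _ (Finset.mem_univ i), h,
      inv_mul_cancel_left₀ (rademacher_real_pos hτ s).ne']
  · have e : {z' : Cube k | z' i = s} ∩ {z} = ∅ := by
      rw [Set.inter_singleton_eq_empty]; exact h
    rw [e]; simp

theorem condWeight_flipAt (hτ : τ ∈ Set.Ioc (0 : ℝ) (1 / 2)) (i : Fin k) (z : Cube k) :
    condWeight τ i (-1) (flipAt z i) = condWeight τ i 1 z := by
  rw [condWeight_eq hτ, condWeight_eq hτ]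
  have h1 : flipAt z i i = -1 ↔ z i = 1 := by simp [flipAt]
  simp only [h1]
  congr 1
  refine Finset.prod_congr rfl fun j hj => ?_
  rw [flipAt, Function.update_of_ne (Finset.ne_of_mem_erase hj)]

theorem sum_real_singleton_eq_one (μ : Measure (Cube k)) [IsProbabilityMeasure μ] :
    ∑ z, μ.real {z} = 1 := by
  rw [sum_measureReal_singleton]
  simp

theorem sum_condWeight (hτ : τ ∈ Set.Ioc (0 : ℝ) (1 / 2)) (i : Fin k) (s : ℤˣ) :
    ∑ z, condWeight τ i s z = 1 := by
  have := isProbabilityMeasure_cubeLaw (k := k) hτ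
  have hpos : cubeLaw k τ {z' | z' i = s} ≠ 0 := fun h => by
    have h1 := cubeLaw_real_eval hτ i s
    rw [Measure.real, h, ENNReal.toReal_zero] at h1
    exact (rademacher_real_pos hτ s).ne h1
  have := cond_isProbabilityMeasure hpos
  exact sum_real_singleton_eq_one _

/-- The law of total probability for the value of `Z_i`. -/
theorem cubeLaw_real_singleton (hτ : τ ∈ Set.Ioc (0 : ℝ) (1 / 2)) (i : Fin k) (z : Cube k) :
    (cubeLaw k τ).real {z} = τ * condWeight τ i 1 z + (1 - τ) * condWeight τ i (-1) z := by
  have := isProbabilityMeasure_rademacher hτ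
  have e2 : (cubeLaw k τ).real {z} = ∏ j, (rademacher τ).real {z j} := by
    simp [Measure.real, cubeLaw, ENNReal.toReal_prod]
  rw [e2, ← Finset.mul_prod_erase _ _ (Finset.mem_univ i), condWeight_eq hτ, condWeight_eq hτ]
  have h : (1 : ℤˣ) ≠ -1 := by decide
  rcases Int.units_eq_one_or (z i) with hz | hz
  · rw [hz, rademacher_real_one hτ]; simp [h]
  · rw [hz, rademacher_real_neg_one hτ]; simp [h.symm]

/-- A function that does not change when the `i`-th sign is flipped has the same mean under the
law of `Z` and under its conditional law given `Z_i = 1`. -/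
theorem sum_cubeLaw_mul_eq (hτ : τ ∈ Set.Ioc (0 : ℝ) (1 / 2)) (i : Fin k) {f : Cube k → ℝ}
    (hf : ∀ z, f (flipAt z i) = f z) :
    ∑ z, (cubeLaw k τ).real {z} * f z = ∑ z, condWeight τ i 1 z * f z := by
  have h : ∑ z, condWeight τ i (-1) z * f z = ∑ z, condWeight τ i 1 z * f z := by
    rw [← Equiv.sum_comp (flipEquiv i)]
    refine Finset.sum_congr rfl fun z _ => ?_
    change condWeight τ i (-1) (flipAt z i) * f (flipAt z i) = _
    rw [condWeight_flipAt hτ, hf]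
  simp_rw [cubeLaw_real_singleton hτ i, add_mul, mul_assoc]
  rw [Finset.sum_add_distrib, ← Finset.mul_sum, ← Finset.mul_sum, h]
  ring

variable {Ω : Type*} [MeasurableSpace Ω]

theorem condMixture_real (Q : Cube k → Measure Ω) [∀ z, IsProbabilityMeasure (Q z)] (i : Fin k)
    (s : ℤˣ) (S : Set Ω) :
    (condMixture τ Q i s).real S = ∑ z, condWeight τ i s z * (Q z).real S := by
  rw [condMixture, Measure.real, Measure.finsetSum_apply, ENNReal.toReal_sum]
  · simp [condWeight, Measure.real]
  · intro z _
    exact ENNReal.mul_ne_top (measure_ne_top _ _) (measure_ne_top _ _)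

/-- Total variation is jointly convex: flipping the `i`-th sign couples the two mixtures. -/
theorem tvDist_condMixture_le (hτ : τ ∈ Set.Ioc (0 : ℝ) (1 / 2)) (Q : Cube k → Measure Ω)
    [∀ z, IsProbabilityMeasure (Q z)] (i : Fin k) :
    tvDist (condMixture τ Q i 1) (condMixture τ Q i (-1)) ≤
      ∑ z, condWeight τ i 1 z * tvDist (Q z) (Q (flipAt z i)) := by
  refine ciSup_le fun S => ?_
  have h : (condMixture τ Q i (-1)).real S.1 =
      ∑ z, condWeight τ i 1 z * (Q (flipAt z i)).real S.1 := by
    rw [condMixture_real, ← Equiv.sum_comp (flipEquiv i)]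
    refine Finset.sum_congr rfl fun z _ => ?_
    rw [← condWeight_flipAt hτ]
    rfl
  rw [h, condMixture_real, ← Finset.sum_sub_distrib]
  refine (Finset.abs_sum_le_sum_abs _ _).trans (Finset.sum_le_sum fun z _ => ?_)
  rw [← mul_sub, abs_mul, abs_of_nonneg (a := condWeight τ i 1 z) measureReal_nonneg]
  exact mul_le_mul_of_nonneg_left (abs_real_sub_le_tvDist _ _ S.2) measureReal_nonneg

/-- A bound, uniform in `z`, on the squared distances between `Q_z` and its neighbours bounds the
average discrepancy. -/
theorem avgDiscrepancy_sq_le (hτ : τ ∈ Set.Ioc (0 : ℝ) (1 / 2)) (Q : Cube k → Measure Ω)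
    [∀ z, IsProbabilityMeasure (Q z)] {B : ℝ}
    (hB : ∀ z, ∑ i, tvDist (Q z) (Q (flipAt z i)) ^ 2 ≤ B) :
    avgDiscrepancy τ Q ^ 2 ≤ 1 / (k : ℝ) * B := by
  have := isProbabilityMeasure_cubeLaw (k := k) hτ
  set T : Fin k → ℝ := fun i => tvDist (condMixture τ Q i 1) (condMixture τ Q i (-1))
  have h1 : ∀ i, T i ^ 2 ≤
      ∑ z, (cubeLaw k τ).real {z} * tvDist (Q z) (Q (flipAt z i)) ^ 2 := by
    intro i
    rw [sum_cubeLaw_mul_eq hτ i (f := fun z => tvDist (Q z) (Q (flipAt z i)) ^ 2)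
      fun z => by rw [flipAt_flipAt, tvDist_comm]]
    refine (pow_le_pow_left₀ (tvDist_nonneg _ _) (tvDist_condMixture_le hτ Q i) 2).trans ?_
    have hcvx : ConvexOn ℝ Set.univ fun x : ℝ => x ^ 2 := even_two.convexOn_pow
    simpa using hcvx.map_sum_le (t := Finset.univ) (w := condWeight τ i 1)
      (p := fun z => tvDist (Q z) (Q (flipAt z i))) (fun z _ => measureReal_nonneg)
      (sum_condWeight hτ i 1) (fun z _ => Set.mem_univ _)
  have h2 : ∑ i, T i ^ 2 ≤ B := by
    calc ∑ i, T i ^ 2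
        ≤ ∑ i, ∑ z, (cubeLaw k τ).real {z} * tvDist (Q z) (Q (flipAt z i)) ^ 2 :=
          Finset.sum_le_sum fun i _ => h1 i
      _ = ∑ z, (cubeLaw k τ).real {z} * ∑ i, tvDist (Q z) (Q (flipAt z i)) ^ 2 := by
          rw [Finset.sum_comm]
          exact Finset.sum_congr rfl fun z _ => (Finset.mul_sum _ _ _).symm
      _ ≤ ∑ z, (cubeLaw k τ).real {z} * B :=
          Finset.sum_le_sum fun z _ => mul_le_mul_of_nonneg_left (hB z) measureReal_nonneg
      _ = B := by rw [← Finset.sum_mul, sum_real_singleton_eq_one, one_mul]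
  have h3 : (∑ i, T i) ^ 2 ≤ k * ∑ i, T i ^ 2 := by
    simpa using sq_sum_le_card_mul_sum_sq (s := Finset.univ) (f := T)
  calc avgDiscrepancy τ Q ^ 2 = (1 / (k : ℝ)) ^ 2 * (∑ i, T i) ^ 2 := by
        rw [avgDiscrepancy, mul_pow]
    _ ≤ (1 / (k : ℝ)) ^ 2 * (k * B) :=
        mul_le_mul_of_nonneg_left
          (h3.trans (mul_le_mul_of_nonneg_left h2 (Nat.cast_nonneg k))) (sq_nonneg _)
    _ = 1 / (k : ℝ) * B := by
        rcases eq_or_ne (k : ℝ) 0 with hk | hk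
        · simp [hk]
        · field_simp

end Mixture

end LocalInference

theorem mainTheorem6 {n k : ℕ} {𝒳 𝒴 𝒰 : Type*} {𝒱 : Fin n → Type*}
    [MeasurableSpace 𝒳] [MeasurableSpace 𝒴] [MeasurableSpace 𝒰] [∀ t, MeasurableSpace (𝒱 t)]
    (ε : ℝ) (hε : 0 < ε) (τ : ℝ) (hτ : τ ∈ Set.Ioc (0 : ℝ) (1 / 2))
    (p : LocalInference.Cube k → Measure 𝒳) (hp : ∀ z, IsProbabilityMeasure (p z))
    (α : ℝ) (a : LocalInference.Cube k → Fin k → ℝ) (φ : LocalInference.Cube k → Fin k → 𝒳 → ℝ)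
    (hdens : LocalInference.DensitiesExist p α a φ)
    (horth : LocalInference.IsOrthonormal p φ)
    (P : LocalInference.SeqProtocol n 𝒳 𝒴 𝒰 𝒱)
    (hP : P.Uses fun t => LocalInference.ldpChannels 𝒳 (Fin t → 𝒴) 𝒴 ε) :
    LocalInference.avgDiscrepancy τ (fun z => P.messageLaw (p z)) ^ 2
        ≤ 7 / (k : ℝ) * (n : ℝ) * α ^ 2 * min ((Real.exp ε - 1) ^ 2) (Real.exp ε) ∧
      LocalInference.avgDiscrepancy τ (fun z => P.transcriptLaw (p z)) ^ 2
        ≤ 7 / (k : ℝ) * (n : ℝ) * α ^ 2 * min ((Real.exp ε - 1) ^ 2) (Real.exp ε) := by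
  have : ∀ z, IsProbabilityMeasure (P.transcriptLaw (p z)) := fun z =>
    LocalInference.SeqProtocol.isProbabilityMeasure_lawUpTo P (p z) n le_rfl
  have : ∀ z, IsProbabilityMeasure (P.messageLaw (p z)) := fun z =>
    Measure.isProbabilityMeasure_map measurable_snd.aemeasurable
  have htr := P.sum_tvDist_sq_transcriptLaw_le hε.le hP hp hdens horth
  set R := min ((Real.exp ε - 1) ^ 2) (Real.exp ε)
  have hR : 0 ≤ R := le_min (sq_nonneg _) (Real.exp_pos ε).le
  -- The argument gives the constant `1` in place of `7`.
  have hfin : 1 / (k : ℝ) * (n * (α ^ 2 * R)) ≤ 7 / (k : ℝ) * (n : ℝ) * α ^ 2 * R := by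
    have h0 : 0 ≤ 1 / (k : ℝ) * (n * (α ^ 2 * R)) := by positivity
    calc 1 / (k : ℝ) * (n * (α ^ 2 * R)) ≤ 7 * (1 / (k : ℝ) * (n * (α ^ 2 * R))) := by linarith
      _ = 7 / (k : ℝ) * (n : ℝ) * α ^ 2 * R := by ring
  refine ⟨(LocalInference.avgDiscrepancy_sq_le hτ _ fun z => ?_).trans hfin,
    (LocalInference.avgDiscrepancy_sq_le hτ _ htr).trans hfin⟩
  refine (Finset.sum_le_sum fun i _ => ?_).trans (htr z)
  exact pow_le_pow_left₀ (LocalInference.tvDist_nonneg _ _)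
    (LocalInference.tvDist_map_le _ _ measurable_snd) 2
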